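/- Let $(\mathscr V,\otimes,\Bbbk)$ be a closed symmetric monoidal category that is also equipped with a model structure. (Only finite limits and colimits are required of a model category, and factorizations need not be functorial.) For an algebra (monoid) $A$ in $\mathscr V$, let $\mathscr V_A$ and ${}_A\mathscr V$ be the categories of right and left $A$-modules. Assume the following. (a) For every algebra $A$ in $\mathscr V$, the category $\mathscr V_A$ is equipped with a model structure whose weak equivalences are created by the forgetful functor to $\mathscr V$ (a morphism of modules is a weak equivalence if and only if its underlying morphism in $\mathscr V$ is), and ${}_A\mathscr V$ likewise admits a model structure whose weak equivalences are created in $\mathscr V$. (b) (CHF hypothesis) For every algebra $A$, every cofibrant right $A$-module $M$ is homotopy flat, i.e., the functor $M\otimes_A-\colon {}_A\mathscr V\to\mathscr V$ preserves weak equivalences. Let $A$ and $B$ be algebras in $\mathscr V$ and let ${}_AX_B$ be an $A$-$B$-bimodule. For a right $B$-module $N$, let $\operatorname{Map}_B(X,N)$ be the equalizer of the two maps $\operatorname{Map}(X,N)\rightrightarrows\operatorname{Map}(X\otimes B,N)$ induced by the right $B$-actions on $X$ and on $N$, with the right $A$-module structure coming from the left $A$-action on $X$. This gives an adjunction $$-\otimes_A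 X\colon \mathscr V_A\rightleftarrows\mathscr V_B\colon \operatorname{Map}_B(X,-).$$ Suppose that it is a Quillen adjunction (the left adjoint preserves cofibrations and trivial cofibrations), that $B$ is fibrant in $\mathscr V_B$, and that $X$ is fibrant and cofibrant as a right $B$-module. Then the adjunction is a Quillen equivalence (for every cofibrant $M$ in $\mathscr V_A$ and every fibrant $N$ in $\mathscr V_B$, a map $M\otimes_AX\to N$ is a weak equivalence if and only if its adjoint $M\to\operatorname{Map}_B(X,N)$ is) if and only if the following three conditions hold: 1. the map $\eta_A\colon A\to\operatorname{Map}_B(X,X)$, adjoint to the canonical isomorphism $A\otimes_AX\cong X$, is a weak equivalence; 2. $X$ is homotopy cofaithful as a right $B$-module in the sense that the functor $\operatorname{Map}_B(X,-)$ reflects weak equivalences between fibrant right $B$-modules; 3. $X$ is homotopy right dualizable, i.e., the canonical map $$\ell_N\colon N\otimes_B\operatorname{Map}_B(X,B)\to\operatorname{Map}_B(X,N),$$ adjoint to $N\otimes_B\operatorname{Map}_B(X,B)\otimes_AX\xrightarrow{1\otimes \mathrm{ev}}N\otimes_BB\cong N$, is a weak equivalence for all fibrant and cofibrant right $B$-modules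 $N$. -/

import Mathlib

open CategoryTheory CategoryTheory.Limits MonoidalCategory MonObj HomotopicalAlgebra

universe v u

namespace HomotopicalMorita


section Closed

variable {V : Type u} [Category.{v} V] [MonoidalCategory V] [SymmetricCategory V]
  [MonoidalClosed V]

instance preservesColimits_tensorRight (X : V) :
    PreservesColimitsOfSize.{0, 0} (tensorRight X) :=
  preservesColimits_of_natIso (BraidedCategory.tensorLeftIsoTensorRight X)

/-- Evaluation `Map(X, N) ⊗ X ⟶ N` for the internal hom. -/
noncomputable def evR (X N : V) : (ihom X).obj N ⊗ X ⟶ N :=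
  (β_ _ _).hom ≫ (ihom.ev X).app N

/-- The transpose `Y ⟶ Map(X, N)` of `f : Y ⊗ X ⟶ N`. -/
noncomputable def curryR {X Y N : V} (f : Y ⊗ X ⟶ N) : Y ⟶ (ihom X).obj N :=
  MonoidalClosed.curry ((β_ X Y).hom ≫ f)

@[simp]
lemma curryR_evR {X Y N : V} (f : Y ⊗ X ⟶ N) : curryR f ▷ X ≫ evR X N = f := by
  have h : X ◁ curryR f ≫ (ihom.ev X).app N = (β_ X Y).hom ≫ f := by
    rw [← MonoidalClosed.uncurry_eq, curryR, MonoidalClosed.uncurry_curry]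
  rw [evR, BraidedCategory.braiding_naturality_left_assoc, h, SymmetricCategory.symmetry_assoc]

lemma hom_ext_evR {X Y N : V} {f g : Y ⟶ (ihom X).obj N}
    (h : f ▷ X ≫ evR X N = g ▷ X ≫ evR X N) : f = g := by
  apply MonoidalClosed.uncurry_injective
  rw [evR, BraidedCategory.braiding_naturality_left_assoc,
    BraidedCategory.braiding_naturality_left_assoc, cancel_epi] at h
  rw [MonoidalClosed.uncurry_eq, MonoidalClosed.uncurry_eq, h]

end Closed

section Map

variable {V : Type u} [Category.{v} V] [MonoidalCategory V] [SymmetricCategory V]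
  [MonoidalClosed V] [HasEqualizers V] {A B C : Mon V}

/-- The map `Map(X, N) ⟶ Map(X ⊗ B, N)` induced by the right action of `B` on `X`. -/
noncomputable def mapTop (X : Bimod A B) (N : Bimod C B) :
    (ihom X.X).obj N.X ⟶ (ihom (X.X ⊗ B.X)).obj N.X :=
  curryR ((ihom X.X).obj N.X ◁ X.actRight ≫ evR X.X N.X)

/-- The map `Map(X, N) ⟶ Map(X ⊗ B, N ⊗ B) ⟶ Map(X ⊗ B, N)`, where the first arrow is `- ⊗ B`
and the second one is induced by the right action of `B` on `N`. -/
noncomputable def mapBot (X : Bimod A B) (N : Bimod C B) :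
    (ihom X.X).obj N.X ⟶ (ihom (X.X ⊗ B.X)).obj N.X :=
  curryR ((α_ _ _ _).inv ≫ evR X.X N.X ▷ B.X ≫ N.actRight)

/-- The object of `V` underlying `Map_B(X, N)`. -/
noncomputable def mapObj (X : Bimod A B) (N : Bimod C B) : V :=
  equalizer (mapTop X N) (mapBot X N)

/-- The inclusion `Map_B(X, N) ⟶ Map(X, N)`. -/
noncomputable def mapι (X : Bimod A B) (N : Bimod C B) : mapObj X N ⟶ (ihom X.X).obj N.X :=
  equalizer.ι (mapTop X N) (mapBot X N)

/-- The evaluation `Map_B(X, N) ⊗ X ⟶ N`. -/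
noncomputable def mapEvAux (X : Bimod A B) (N : Bimod C B) : mapObj X N ⊗ X.X ⟶ N.X :=
  mapι X N ▷ X.X ≫ evR X.X N.X

variable {X : Bimod A B} {N : Bimod C B}

/-- `B`-linearity (in the second variable) of a map `K ⊗ X ⟶ N`. -/
def IsBLinear (X : Bimod A B) (N : Bimod C B) {K : V} (g : K ⊗ X.X ⟶ N.X) : Prop :=
  K ◁ X.actRight ≫ g = (α_ K X.X B.X).inv ≫ g ▷ B.X ≫ N.actRight

lemma mapTop_eq_iff {K : V} (f : K ⟶ (ihom X.X).obj N.X) :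
    f ≫ mapTop X N = f ≫ mapBot X N ↔ IsBLinear X N (f ▷ X.X ≫ evR X.X N.X) := by
  have h1 : (f ≫ mapTop X N) ▷ (X.X ⊗ B.X) ≫ evR (X.X ⊗ B.X) N.X =
      K ◁ X.actRight ≫ f ▷ X.X ≫ evR X.X N.X := by
    rw [comp_whiskerRight, Category.assoc, mapTop, curryR_evR, whisker_exchange_assoc]
  have h2 : (f ≫ mapBot X N) ▷ (X.X ⊗ B.X) ≫ evR (X.X ⊗ B.X) N.X =
      (α_ K X.X B.X).inv ≫ (f ▷ X.X ≫ evR X.X N.X) ▷ B.X ≫ N.actRight := by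
    rw [comp_whiskerRight, Category.assoc, mapBot, curryR_evR, comp_whiskerRight, Category.assoc,
      associator_inv_naturality_left_assoc]
  refine ⟨fun h => ?_, fun h => hom_ext_evR ?_⟩
  · rw [IsBLinear, ← h1, ← h2, h]
  · rw [h1, h2, h]

lemma isBLinear_mapEvAux (X : Bimod A B) (N : Bimod C B) : IsBLinear X N (mapEvAux X N) :=
  (mapTop_eq_iff _).1 (equalizer.condition _ _)

/-- The transpose `K ⟶ Map_B(X, N)` of a `B`-linear map `K ⊗ X ⟶ N`. -/
noncomputable def mapLiftAux {K : V} (g : K ⊗ X.X ⟶ N.X) (hg : IsBLinear X N g) :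
    K ⟶ mapObj X N :=
  equalizer.lift (curryR g) ((mapTop_eq_iff _).2 (by rwa [curryR_evR]))

lemma mapLiftAux_ι {K : V} (g : K ⊗ X.X ⟶ N.X) (hg : IsBLinear X N g) :
    mapLiftAux g hg ≫ mapι X N = curryR g :=
  equalizer.lift_ι _ _

lemma mapLiftAux_ev {K : V} (g : K ⊗ X.X ⟶ N.X) (hg : IsBLinear X N g) :
    mapLiftAux g hg ▷ X.X ≫ mapEvAux X N = g := by
  rw [mapEvAux, ← comp_whiskerRight_assoc, mapLiftAux_ι, curryR_evR]

lemma mapObj_hom_ext {K : V} {f g : K ⟶ mapObj X N}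
    (h : f ▷ X.X ≫ mapEvAux X N = g ▷ X.X ≫ mapEvAux X N) : f = g := by
  have h' : f ≫ mapι X N = g ≫ mapι X N := hom_ext_evR (by simpa [mapEvAux] using h)
  exact equalizer.hom_ext h'

variable (X N)

lemma isBLinear_left : IsBLinear X N
    ((α_ C.X (mapObj X N) X.X).hom ≫ C.X ◁ mapEvAux X N ≫ N.actLeft) := by
  have h := isBLinear_mapEvAux X N
  unfold IsBLinear at h ⊢
  rw [associator_naturality_right_assoc, ← MonoidalCategory.whiskerLeft_comp_assoc, h]
  simp only [MonoidalCategory.whiskerLeft_comp, comp_whiskerRight, Category.assoc,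
    Bimod.middle_assoc, whisker_assoc, Iso.inv_hom_id_assoc]
  monoidal

lemma isBLinear_right : IsBLinear X N
    ((α_ (mapObj X N) A.X X.X).hom ≫ mapObj X N ◁ X.actLeft ≫ mapEvAux X N) := by
  have h := isBLinear_mapEvAux X N
  have h' : mapEvAux X N ▷ B.X ≫ N.actRight =
      (α_ _ _ _).hom ≫ mapObj X N ◁ X.actRight ≫ mapEvAux X N := by
    rw [h, Iso.hom_inv_id_assoc]
  unfold IsBLinear
  simp only [comp_whiskerRight, Category.assoc, whisker_assoc, h', Iso.inv_hom_id_assoc,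
    associator_naturality_right_assoc]
  rw [← MonoidalCategory.whiskerLeft_comp_assoc (mapObj X N) (X.actLeft ▷ B.X), X.middle_assoc]
  simp only [MonoidalCategory.whiskerLeft_comp, Category.assoc]
  monoidal

/-- The left action of `C` on `Map_B(X, N)`. -/
noncomputable def mapActLeft : C.X ⊗ mapObj X N ⟶ mapObj X N :=
  mapLiftAux _ (isBLinear_left X N)

/-- The right action of `A` on `Map_B(X, N)`. -/
noncomputable def mapActRight : mapObj X N ⊗ A.X ⟶ mapObj X N :=
  mapLiftAux _ (isBLinear_right X N)

lemma mapActLeft_ev : mapActLeft X N ▷ X.X ≫ mapEvAux X N =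
    (α_ C.X (mapObj X N) X.X).hom ≫ C.X ◁ mapEvAux X N ≫ N.actLeft :=
  mapLiftAux_ev _ _

lemma mapActRight_ev : mapActRight X N ▷ X.X ≫ mapEvAux X N =
    (α_ (mapObj X N) A.X X.X).hom ≫ mapObj X N ◁ X.actLeft ≫ mapEvAux X N :=
  mapLiftAux_ev _ _

/-- `Map_B(X, N)` as a `C`-`A`-bimodule. The left action of `C` comes from `N`, the right action of
`A` comes from the left action on `X`. -/
noncomputable def mapBimod : Bimod C A where
  X := mapObj X N
  actLeft := mapActLeft X N
  actRight := mapActRight X N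
  one_actLeft := by
    apply mapObj_hom_ext
    rw [comp_whiskerRight, Category.assoc, mapActLeft_ev, associator_naturality_left_assoc,
      ← whisker_exchange_assoc, N.one_actLeft]
    monoidal
  left_assoc := by
    apply mapObj_hom_ext
    simp only [comp_whiskerRight, Category.assoc, mapActLeft_ev, whisker_assoc,
      associator_naturality_left_assoc, Iso.inv_hom_id_assoc]
    rw [← whisker_exchange_assoc, N.left_assoc, ← MonoidalCategory.whiskerLeft_comp_assoc
      C.X (mapActLeft X N ▷ X.X), mapActLeft_ev]
    monoidal
  actRight_one := by
    apply mapObj_hom_ext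
    simp only [comp_whiskerRight, Category.assoc, mapActRight_ev, whisker_assoc,
      Iso.inv_hom_id_assoc]
    rw [← MonoidalCategory.whiskerLeft_comp_assoc, X.one_actLeft]
    monoidal
  right_assoc := by
    apply mapObj_hom_ext
    simp only [comp_whiskerRight, Category.assoc, mapActRight_ev, whisker_assoc,
      Iso.inv_hom_id_assoc, associator_naturality_left_assoc]
    rw [← MonoidalCategory.whiskerLeft_comp_assoc, X.left_assoc, ← whisker_exchange_assoc,
      mapActRight_ev]
    simp only [MonoidalCategory.whiskerLeft_comp, Category.assoc]
    monoidal
  middle_assoc := by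
    apply mapObj_hom_ext
    simp only [comp_whiskerRight, Category.assoc, mapActRight_ev, mapActLeft_ev, whisker_assoc,
      Iso.inv_hom_id_assoc, associator_naturality_left_assoc]
    rw [← whisker_exchange_assoc, mapActLeft_ev, ← MonoidalCategory.whiskerLeft_comp_assoc
      C.X (mapActRight X N ▷ X.X), mapActRight_ev]
    simp only [MonoidalCategory.whiskerLeft_comp, Category.assoc]
    monoidal

/-- The evaluation `Map_B(X, N) ⊗ X ⟶ N`. -/
noncomputable def mapEv (X : Bimod A B) (N : Bimod C B) : (mapBimod X N).X ⊗ X.X ⟶ N.X :=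
  mapEvAux X N

variable {X N}

/-- The transpose `K ⟶ Map_B(X, N)` of a `B`-linear map `K ⊗ X ⟶ N`. -/
noncomputable def mapLift {K : V} (g : K ⊗ X.X ⟶ N.X) (hg : IsBLinear X N g) :
    K ⟶ (mapBimod X N).X :=
  mapLiftAux g hg

lemma mapLift_ev {K : V} (g : K ⊗ X.X ⟶ N.X) (hg : IsBLinear X N g) :
    mapLift g hg ▷ X.X ≫ mapEv X N = g :=
  mapLiftAux_ev g hg

lemma map_hom_ext {K : V} {f g : K ⟶ (mapBimod X N).X}
    (h : f ▷ X.X ≫ mapEv X N = g ▷ X.X ≫ mapEv X N) : f = g :=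
  mapObj_hom_ext h

variable (X N)

lemma mapEv_actRight : (mapBimod X N).X ◁ X.actRight ≫ mapEv X N =
    (α_ _ _ _).inv ≫ mapEv X N ▷ B.X ≫ N.actRight :=
  isBLinear_mapEvAux X N

lemma actLeft_mapEv : (mapBimod X N).actLeft ▷ X.X ≫ mapEv X N =
    (α_ _ _ _).hom ≫ C.X ◁ mapEv X N ≫ N.actLeft :=
  mapActLeft_ev X N

lemma actRight_mapEv : (mapBimod X N).actRight ▷ X.X ≫ mapEv X N =
    (α_ _ _ _).hom ≫ (mapBimod X N).X ◁ X.actLeft ≫ mapEv X N :=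
  mapActRight_ev X N

variable {N}

lemma isBLinear_mapEv_comp {N N' : Bimod C B} (f : N ⟶ N') :
    IsBLinear X N' (mapEv X N ≫ f.hom) := by
  unfold IsBLinear
  rw [← Category.assoc, mapEv_actRight, Category.assoc, Category.assoc, f.right_act_hom,
    comp_whiskerRight, Category.assoc]

/-- The map `Map_B(X, N) ⟶ Map_B(X, N')` induced by `f : N ⟶ N'`. -/
noncomputable def mapMap {N N' : Bimod C B} (f : N ⟶ N') : mapBimod X N ⟶ mapBimod X N' where
  hom := mapLift (mapEv X N ≫ f.hom) (isBLinear_mapEv_comp X f)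
  left_act_hom := by
    apply map_hom_ext
    rw [comp_whiskerRight, Category.assoc, mapLift_ev, ← Category.assoc, actLeft_mapEv,
      comp_whiskerRight, Category.assoc, Category.assoc, Category.assoc, actLeft_mapEv,
      whisker_assoc]
    simp only [Category.assoc, Iso.inv_hom_id_assoc]
    rw [← MonoidalCategory.whiskerLeft_comp_assoc, mapLift_ev, f.left_act_hom,
      MonoidalCategory.whiskerLeft_comp_assoc]
  right_act_hom := by
    apply map_hom_ext
    rw [comp_whiskerRight, Category.assoc, mapLift_ev, ← Category.assoc, actRight_mapEv,
      comp_whiskerRight, Category.assoc, Category.assoc, Category.assoc, actRight_mapEv,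
      associator_naturality_left_assoc, ← whisker_exchange_assoc, mapLift_ev]

lemma mapMap_ev {N N' : Bimod C B} (f : N ⟶ N') :
    (mapMap X f).hom ▷ X.X ≫ mapEv X N' = mapEv X N ≫ f.hom :=
  mapLift_ev _ (isBLinear_mapEv_comp X f)

/-- The functor `Map_B(X, -)` from `C`-`B`-bimodules to `C`-`A`-bimodules. -/
noncomputable def mapFunctor : Bimod C B ⥤ Bimod C A where
  obj N := mapBimod X N
  map f := mapMap X f
  map_id N := by
    apply Bimod.hom_ext
    apply map_hom_ext
    rw [mapMap_ev, Bimod.id_hom', Bimod.id_hom', id_whiskerRight, Category.id_comp,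
      Category.comp_id]
  map_comp f g := by
    apply Bimod.hom_ext
    apply map_hom_ext
    rw [mapMap_ev, Bimod.comp_hom', Bimod.comp_hom', comp_whiskerRight, Category.assoc, mapMap_ev,
      ← Category.assoc, ← Category.assoc, mapMap_ev]

end Map

section Tensor

variable {V : Type u} [Category.{v} V] [MonoidalCategory V] [SymmetricCategory V]
  [MonoidalClosed V] [HasCoequalizers V] {A B C : Mon V}

/-- The functor `- ⊗_A X` from `C`-`A`-bimodules to `C`-`B`-bimodules. -/
noncomputable def tensorFunctor (X : Bimod A B) : Bimod C A ⥤ Bimod C B where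
  obj M := M.tensorBimod X
  map f := Bimod.whiskerRight f X
  map_id _ := Bimod.id_whiskerRight_bimod
  map_comp f g := Bimod.comp_whiskerRight_bimod f g X

/-- The projection `M ⊗ X ⟶ M ⊗_A X`. -/
noncomputable def tensorπ (M : Bimod C A) (X : Bimod A B) :
    M.X ⊗ X.X ⟶ (M.tensorBimod X).X :=
  coequalizer.π (M.actRight ▷ X.X) ((α_ _ _ _).hom ≫ (M.X ◁ X.actLeft))

variable (M : Bimod C A) (X : Bimod A B) (N : Bimod C B)

lemma tensorπ_condition : M.actRight ▷ X.X ≫ tensorπ M X =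
    (α_ _ _ _).hom ≫ M.X ◁ X.actLeft ≫ tensorπ M X :=
  (coequalizer.condition (M.actRight ▷ X.X) ((α_ _ _ _).hom ≫ (M.X ◁ X.actLeft))).trans
    (Category.assoc _ _ _)

lemma tensorπ_actLeft : C.X ◁ tensorπ M X ≫ (M.tensorBimod X).actLeft =
    (α_ _ _ _).inv ≫ M.actLeft ▷ X.X ≫ tensorπ M X :=
  Bimod.TensorBimod.whiskerLeft_π_actLeft M X

lemma tensorπ_actRight : tensorπ M X ▷ B.X ≫ (M.tensorBimod X).actRight =
    (α_ _ _ _).hom ≫ M.X ◁ X.actRight ≫ tensorπ M X :=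
  Bimod.TensorBimod.π_tensor_id_actRight M X

variable {M X N}

lemma tensor_hom_ext {Z : V} {f g : (M.tensorBimod X).X ⟶ Z}
    (h : tensorπ M X ≫ f = tensorπ M X ≫ g) : f = g :=
  coequalizer.hom_ext h

instance epi_whiskerLeft_tensorπ (W : V) : Epi (W ◁ tensorπ M X) :=
  inferInstanceAs (Epi ((tensorLeft W).map (coequalizer.π (M.actRight ▷ X.X)
    ((α_ _ _ _).hom ≫ (M.X ◁ X.actLeft)))))

instance epi_whiskerRight_tensorπ (W : V) : Epi (tensorπ M X ▷ W) :=
  inferInstanceAs (Epi ((tensorRight W).map (coequalizer.π (M.actRight ▷ X.X)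
    ((α_ _ _ _).hom ≫ (M.X ◁ X.actLeft)))))

/-- The map `M ⊗_A X ⟶ Z` induced by a map `M ⊗ X ⟶ Z` that is balanced over `A`. -/
noncomputable def tensorDesc {Z : V} (k : M.X ⊗ X.X ⟶ Z)
    (hk : M.actRight ▷ X.X ≫ k = (α_ _ _ _).hom ≫ M.X ◁ X.actLeft ≫ k) :
    (M.tensorBimod X).X ⟶ Z :=
  coequalizer.desc k (by rw [hk, Category.assoc])

lemma tensorπ_desc {Z : V} (k : M.X ⊗ X.X ⟶ Z)
    (hk : M.actRight ▷ X.X ≫ k = (α_ _ _ _).hom ≫ M.X ◁ X.actLeft ≫ k) :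
    tensorπ M X ≫ tensorDesc k hk = k :=
  coequalizer.π_desc _ _

lemma tensorπ_whiskerRight {M' : Bimod C A} (f : M ⟶ M') :
    tensorπ M X ≫ (Bimod.whiskerRight f X).hom = f.hom ▷ X.X ≫ tensorπ M' X :=
  ι_colimMap _ _

variable [HasEqualizers V]

lemma isBLinear_tensorπ_comp (f : M.tensorBimod X ⟶ N) : IsBLinear X N (tensorπ M X ≫ f.hom) := by
  unfold IsBLinear
  rw [comp_whiskerRight, Category.assoc, ← f.right_act_hom, ← Category.assoc (tensorπ M X ▷ B.X),
    tensorπ_actRight]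
  simp only [Category.assoc, Iso.inv_hom_id_assoc]

/-- The transpose `M ⟶ Map_B(X, N)` of a bimodule map `M ⊗_A X ⟶ N`. -/
noncomputable def transpose (f : M.tensorBimod X ⟶ N) : M ⟶ mapBimod X N where
  hom := mapLift (tensorπ M X ≫ f.hom) (isBLinear_tensorπ_comp f)
  left_act_hom := by
    apply map_hom_ext
    rw [comp_whiskerRight, Category.assoc, mapLift_ev, comp_whiskerRight, Category.assoc,
      actLeft_mapEv, whisker_assoc]
    simp only [Category.assoc, Iso.inv_hom_id_assoc]
    rw [← MonoidalCategory.whiskerLeft_comp_assoc, mapLift_ev, MonoidalCategory.whiskerLeft_comp,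
      Category.assoc, ← f.left_act_hom, ← Category.assoc (C.X ◁ tensorπ M X), tensorπ_actLeft]
    simp only [Category.assoc, Iso.hom_inv_id_assoc]
  right_act_hom := by
    apply map_hom_ext
    rw [comp_whiskerRight, Category.assoc, mapLift_ev, comp_whiskerRight, Category.assoc,
      actRight_mapEv, associator_naturality_left_assoc, ← whisker_exchange_assoc, mapLift_ev,
      ← Category.assoc, tensorπ_condition]
    simp only [Category.assoc]

lemma transpose_ev (f : M.tensorBimod X ⟶ N) :
    (transpose f).hom ▷ X.X ≫ mapEv X N = tensorπ M X ≫ f.hom :=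
  mapLift_ev _ (isBLinear_tensorπ_comp f)

lemma balanced_mapEv (g : M ⟶ mapBimod X N) :
    M.actRight ▷ X.X ≫ g.hom ▷ X.X ≫ mapEv X N =
      (α_ _ _ _).hom ≫ M.X ◁ X.actLeft ≫ g.hom ▷ X.X ≫ mapEv X N := by
  rw [← comp_whiskerRight_assoc, g.right_act_hom, comp_whiskerRight, Category.assoc,
    actRight_mapEv, associator_naturality_left_assoc, ← whisker_exchange_assoc]

/-- The transpose `M ⊗_A X ⟶ N` of a bimodule map `M ⟶ Map_B(X, N)`. -/
noncomputable def untranspose (g : M ⟶ mapBimod X N) : M.tensorBimod X ⟶ N where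
  hom := tensorDesc (g.hom ▷ X.X ≫ mapEv X N) (balanced_mapEv g)
  left_act_hom := by
    rw [← cancel_epi (C.X ◁ tensorπ M X), ← Category.assoc, tensorπ_actLeft,
      ← MonoidalCategory.whiskerLeft_comp_assoc, tensorπ_desc, Category.assoc, Category.assoc,
      tensorπ_desc, ← comp_whiskerRight_assoc, g.left_act_hom, comp_whiskerRight, Category.assoc,
      actLeft_mapEv, whisker_assoc]
    simp only [Category.assoc, Iso.inv_hom_id_assoc, MonoidalCategory.whiskerLeft_comp]
  right_act_hom := by
    rw [← cancel_epi (tensorπ M X ▷ B.X), ← Category.assoc, tensorπ_actRight,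
      ← comp_whiskerRight_assoc (tensorπ M X), tensorπ_desc, Category.assoc, Category.assoc,
      tensorπ_desc, whisker_exchange_assoc, mapEv_actRight, comp_whiskerRight]
    simp

lemma tensorπ_untranspose (g : M ⟶ mapBimod X N) :
    tensorπ M X ≫ (untranspose g).hom = g.hom ▷ X.X ≫ mapEv X N :=
  tensorπ_desc _ (balanced_mapEv g)

/-- The bijection between bimodule maps `M ⊗_A X ⟶ N` and bimodule maps `M ⟶ Map_B(X, N)`. -/
noncomputable def transposeEquiv (M : Bimod C A) (X : Bimod A B) (N : Bimod C B) :
    (M.tensorBimod X ⟶ N) ≃ (M ⟶ mapBimod X N) where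
  toFun := transpose
  invFun := untranspose
  left_inv f := by
    apply Bimod.hom_ext
    apply tensor_hom_ext
    rw [tensorπ_untranspose, transpose_ev]
  right_inv g := by
    apply Bimod.hom_ext
    apply map_hom_ext
    rw [transpose_ev, tensorπ_untranspose]

lemma untranspose_comp {M' : Bimod C A} (f : M' ⟶ M) (g : M ⟶ mapBimod X N) :
    untranspose (f ≫ g) = Bimod.whiskerRight f X ≫ untranspose g := by
  apply Bimod.hom_ext
  apply tensor_hom_ext
  rw [tensorπ_untranspose, Bimod.comp_hom', Bimod.comp_hom', ← Category.assoc,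
    tensorπ_whiskerRight, Category.assoc, tensorπ_untranspose, comp_whiskerRight, Category.assoc]

lemma transpose_comp {N' : Bimod C B} (f : M.tensorBimod X ⟶ N) (g : N ⟶ N') :
    transpose (f ≫ g) = transpose f ≫ mapMap X g := by
  apply Bimod.hom_ext
  apply map_hom_ext
  rw [transpose_ev, Bimod.comp_hom', Bimod.comp_hom', comp_whiskerRight, Category.assoc, mapMap_ev,
    ← Category.assoc (_ ▷ _), transpose_ev, Category.assoc]

/-- The adjunction `- ⊗_A X ⊣ Map_B(X, -)` between `C`-`A`-bimodules and `C`-`B`-bimodules. -/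
noncomputable def tensorMapAdj (X : Bimod A B) :
    tensorFunctor (C := C) X ⊣ mapFunctor (C := C) X :=
  Adjunction.mkOfHomEquiv
    { homEquiv := fun M N => transposeEquiv M X N
      homEquiv_naturality_left_symm := fun f g => untranspose_comp f g
      homEquiv_naturality_right := fun f g => transpose_comp f g }

end Tensor

section Modules

variable {V : Type u} [Category.{v} V] [MonoidalCategory V]

/-- The category `V_A` of right modules over an algebra `A`. A right `A`-module is the same thing as
a `𝟙_ V`-`A`-bimodule, because the left action of the unit object is necessarily the left unitor:
see `RightMod.ofAction`, `RightMod.actLeft_eq` and `RightMod.homMk`. -/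
abbrev RightMod (A : Mon V) : Type (max u v) := Bimod (Mon.trivial V) A

/-- The category of left modules over an algebra `A`, i.e. of `A`-`𝟙_ V`-bimodules. -/
abbrev LeftMod (A : Mon V) : Type (max u v) := Bimod A (Mon.trivial V)

/-- The right `A`-module given by an object with a right action of `A`. -/
def RightMod.ofAction {A : Mon V} (M : V) (ρ : M ⊗ A.X ⟶ M)
    (hone : M ◁ η[A.X] ≫ ρ = (ρ_ M).hom)
    (hmul : M ◁ μ[A.X] ≫ ρ = (α_ M A.X A.X).inv ≫ ρ ▷ A.X ≫ ρ) : RightMod A where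
  X := M
  actLeft := (λ_ M).hom
  one_actLeft := by
    change 𝟙 (𝟙_ V) ▷ M ≫ _ = _
    simp
  left_assoc := by
    change (λ_ (𝟙_ V)).hom ▷ M ≫ _ = (α_ (𝟙_ V) (𝟙_ V) M).hom ≫ 𝟙_ V ◁ _ ≫ _
    monoidal
  actRight := ρ
  actRight_one := hone
  right_assoc := hmul
  middle_assoc := by
    change (λ_ M).hom ▷ A.X ≫ ρ = (α_ (𝟙_ V) M A.X).hom ≫ 𝟙_ V ◁ ρ ≫ (λ_ M).hom
    simp

lemma RightMod.actLeft_eq {A : Mon V} (M : RightMod A) : M.actLeft = (λ_ M.X).hom :=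
  (Category.id_comp M.actLeft).symm.trans
    ((congrArg (fun k => k ≫ M.actLeft) (id_whiskerRight (𝟙_ V) M.X).symm).trans M.one_actLeft)

/-- A map that commutes with the right actions is a morphism of right modules. -/
def RightMod.homMk {A : Mon V} {M N : RightMod A} (f : M.X ⟶ N.X)
    (hf : M.actRight ≫ f = f ▷ A.X ≫ N.actRight) : M ⟶ N where
  hom := f
  left_act_hom := by
    rw [M.actLeft_eq, N.actLeft_eq]
    exact (leftUnitor_naturality f).symm
  right_act_hom := hf

/-- The right `B`-module underlying an `A`-`B`-bimodule. -/
def rightPart {A B : Mon V} (X : Bimod A B) : RightMod B :=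
  RightMod.ofAction X.X X.actRight X.actRight_one X.right_assoc

end Modules

section Quillen

variable {M : Type*} [Category* M] {N : Type*} [Category* N]
  [ModelCategory M] [ModelCategory N] {F : M ⥤ N} {G : N ⥤ M}

/-- An adjunction between model categories is a Quillen adjunction if the left adjoint preserves
cofibrations and trivial cofibrations. -/
structure IsQuillenAdjunction (_adj : F ⊣ G) : Prop where
  map_cofibration : ∀ {K L : M} (i : K ⟶ L), Cofibration i → Cofibration (F.map i)
  map_trivialCofibration : ∀ {K L : M} (i : K ⟶ L), Cofibration i → WeakEquivalence i →
    WeakEquivalence (F.map i)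

/-- A Quillen adjunction is a Quillen equivalence if for every cofibrant `K` and every fibrant `L`,
a map `F K ⟶ L` is a weak equivalence if and only if its adjoint `K ⟶ G L` is one. -/
structure IsQuillenEquivalence (adj : F ⊣ G) : Prop extends IsQuillenAdjunction adj where
  weakEquivalence_iff : ∀ {K : M} {L : N}, IsCofibrant K → IsFibrant L → ∀ f : F.obj K ⟶ L,
    WeakEquivalence f ↔ WeakEquivalence (adj.homEquiv K L f)

end Quillen

section Homotopy

variable (V : Type u) [Category.{v} V] [MonoidalCategory V] [SymmetricCategory V]
  [MonoidalClosed V] [ModelCategory V] [∀ A : Mon V, ModelCategory (RightMod A)]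

/-- For every algebra `A`, the forgetful functor creates the weak equivalences of the given model
structure on right `A`-modules, and left `A`-modules admit a model structure whose weak equivalences
are created by the forgetful functor. -/
structure ModuleHypothesis : Prop where
  right : ∀ (A : Mon V) {M N : RightMod A} (f : M ⟶ N),
    WeakEquivalence f ↔ WeakEquivalence f.hom
  left : ∀ A : Mon V, ∃ _ : ModelCategory (LeftMod A), ∀ {M N : LeftMod A} (f : M ⟶ N),
    WeakEquivalence f ↔ WeakEquivalence f.hom

variable {V} in
/-- A right `A`-module `M` is homotopy flat if `M ⊗_A -`, from left `A`-modules to `V`, preserves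
weak equivalences. (The weak equivalences of left `A`-modules are created in `V`.) -/
def HomotopyFlat {A : Mon V} (M : RightMod A) : Prop :=
  ∀ {P Q : LeftMod A} (f : P ⟶ Q), WeakEquivalence f.hom →
    WeakEquivalence (Bimod.whiskerLeft M f).hom

/-- Every cofibrant right module over every algebra is homotopy flat. -/
def CHFHypothesis : Prop :=
  ∀ (A : Mon V) (M : RightMod A), IsCofibrant M → HomotopyFlat M

variable {V} {A B : Mon V} (X : Bimod A B)

/-- The adjunction `- ⊗_A X ⊣ Map_B(X, -)` between `V_A` and `V_B` governed by `X`. -/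
noncomputable def governedAdj :
    tensorFunctor (C := Mon.trivial V) X ⊣ mapFunctor (C := Mon.trivial V) X :=
  tensorMapAdj X

/-- The map `η_A : A ⟶ Map_B(X, X)` (of `A`-bimodules) adjoint to `A ⊗_A X ≅ X`. -/
noncomputable def unitMap : Bimod.regular A ⟶ mapBimod X X :=
  transpose (Bimod.leftUnitorBimod X).hom

/-- The evaluation `Map_B(X, B) ⊗_A X ⟶ B`, a map of `B`-bimodules. -/
noncomputable def dualEv :
    (mapBimod X (Bimod.regular B)).tensorBimod X ⟶ Bimod.regular B :=
  untranspose (𝟙 _)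

/-- The map `ℓ_N : N ⊗_B Map_B(X, B) ⟶ Map_B(X, N)` of right `A`-modules, adjoint to
`N ⊗_B Map_B(X, B) ⊗_A X ⟶ N ⊗_B B ≅ N`. -/
noncomputable def dualMap (N : RightMod B) :
    N.tensorBimod (mapBimod X (Bimod.regular B)) ⟶ mapBimod X N :=
  transpose ((Bimod.associatorBimod N (mapBimod X (Bimod.regular B)) X).hom ≫
    Bimod.whiskerLeft N (dualEv X) ≫ (Bimod.rightUnitorBimod N).hom)

/-- `Map_B(X, -) : V_B ⟶ V` reflects weak equivalences between fibrant objects. -/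
def HomotopyCofaithful : Prop :=
  ∀ {M N : RightMod B}, IsFibrant M → IsFibrant N → ∀ f : M ⟶ N,
    WeakEquivalence (mapMap X f).hom → WeakEquivalence f

/-- For a bimodule `X` that is fibrant and cofibrant as a right `B`-module: `ℓ_N` is a weak
equivalence for every fibrant and cofibrant right `B`-module `N`. -/
def HomotopyRightDualizable : Prop :=
  ∀ N : RightMod B, IsFibrant N → IsCofibrant N → WeakEquivalence (dualMap X N)

end Homotopy

end HomotopicalMorita

/-!
A cofibrant replacement of `X` over the opposite of `A` is a weak equivalence `Q ⟶ X` of left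
modules with `Q` flat on the left, so `- ⊗_A Q` computes the derived tensor product with `X`. If the
adjunction is a Quillen equivalence, `M ⟶ Map_B(X, N)` is therefore a weak equivalence for
*arbitrary* `M` and fibrant `N` as soon as `M ⊗_A Q ⟶ M ⊗_A X ⟶ N` is one. For `η_A` this composite
is `Q ⟶ X` up to the unitor; for the identity of `Map_B(X, N)` it is the derived evaluation, which
is thus a weak equivalence; and for `ℓ_N` with `N` flat it is `N` tensored with the derived
evaluation of `Map_B(X, B)`.

Conversely, by the second condition and Ken Brown's lemma it suffices that
`M ⟶ Map_B(X, M ⊗_A X) ⟶ Map_B(X, R)` is a weak equivalence for `M` cofibrant and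
`j : M ⊗_A X ⟶ R` a fibrant replacement. The composite of the assembly map
`M ⊗_A Map_B(X, X) ⟶ Map_B(X, M ⊗_A X)` with `Map_B(X, j)` connects this to `M ⊗_A η_A`. Its
precomposite with `M ⊗_A ℓ_X` is `j ⊗_B Map_B(X, B)` followed by `ℓ_R`, so it is a weak equivalence.
-/

namespace HomotopicalMorita

section QuillenAdjunctions

variable {M : Type*} [Category* M] {N : Type*} [Category* N]
  [ModelCategory M] [ModelCategory N] {F : M ⥤ N} {G : N ⥤ M} {adj : F ⊣ G}

namespace IsQuillenAdjunction

lemma isCofibrant_obj (h : IsQuillenAdjunction adj) {K : M} (hK : IsCofibrant K) :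
    IsCofibrant (F.obj K) := by
  have := adj.leftAdjoint_preservesColimits
  have hI : IsInitial (F.obj (⊥_ M)) := IsInitial.isInitialObj F _ initialIsInitial
  exact (isCofibrant_iff_of_isInitial (F.map (initial.to K)) hI).2 (h.map_cofibration _ hK)

lemma weakEquivalence_map_of_fibration (h : IsQuillenAdjunction adj) {K L : N} (p : K ⟶ L)
    [Fibration p] [WeakEquivalence p] : WeakEquivalence (G.map p) := by
  have hrlp : (cofibrations M).rlp (G.map p) := by
    intro A B i hi
    have := h.map_cofibration i ((cofibration_iff _).2 hi)
    rw [← adj.hasLiftingProperty_iff]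
    infer_instance
  rw [cofibrations_rlp] at hrlp
  exact (weakEquivalence_iff _).2 hrlp.2

/-- Ken Brown's lemma. -/
lemma weakEquivalence_map (h : IsQuillenAdjunction adj) {K L : N} (f : K ⟶ L) [IsFibrant K]
    [IsFibrant L] [WeakEquivalence f] : WeakEquivalence (G.map f) := by
  let b := Classical.arbitrary (FibrantBrownFactorization f)
  have hp : WeakEquivalence (G.map b.p) := h.weakEquivalence_map_of_fibration b.p
  have hr : WeakEquivalence (G.map b.r) := h.weakEquivalence_map_of_fibration b.r
  have hi : WeakEquivalence (G.map b.i) :=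
    weakEquivalence_of_postcomp_of_fac
      (show G.map b.i ≫ G.map b.r = 𝟙 _ by rw [← G.map_comp, b.i_r, G.map_id])
  rw [← b.fac, G.map_comp]
  infer_instance

lemma isQuillenEquivalence (h : IsQuillenAdjunction adj)
    (reflects : ∀ {K L : N}, IsFibrant K → IsFibrant L → ∀ f : K ⟶ L,
      WeakEquivalence (G.map f) → WeakEquivalence f)
    (derivedUnit : ∀ {K : M} {R : N}, IsCofibrant K → IsFibrant R → ∀ j : F.obj K ⟶ R,
      Cofibration j → WeakEquivalence j → WeakEquivalence (adj.homEquiv K R j)) :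
    IsQuillenEquivalence adj where
  toIsQuillenAdjunction := h
  weakEquivalence_iff {K L} hK hL f := by
    obtain ⟨R, hR, j, hj, hj'⟩ := FibrantObject.HoCat.exists_resolution (F.obj K)
    have sq : CommSq f j (terminal.from L) (terminal.from R) := ⟨Subsingleton.elim _ _⟩
    obtain ⟨g, rfl⟩ : ∃ g : R ⟶ L, j ≫ g = f := ⟨sq.lift, sq.fac_left⟩
    have := derivedUnit hK hR j hj hj'
    rw [adj.homEquiv_naturality_right, weakEquivalence_precomp_iff, weakEquivalence_precomp_iff]
    exact ⟨fun _ => h.weakEquivalence_map g, reflects hR hL g⟩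

end IsQuillenAdjunction

lemma IsQuillenEquivalence.weakEquivalence_of_map (h : IsQuillenEquivalence adj) {K L : N}
    (hK : IsFibrant K) (hL : IsFibrant L) (f : K ⟶ L) (hf : WeakEquivalence (G.map f)) :
    WeakEquivalence f := by
  obtain ⟨Q, hQ, q, -, hq⟩ := CofibrantObject.HoCat.exists_resolution (G.obj K)
  have h₁ : WeakEquivalence ((adj.homEquiv Q K).symm q) := by
    rwa [h.weakEquivalence_iff hQ hK, Equiv.apply_symm_apply]
  have h₂ : WeakEquivalence ((adj.homEquiv Q K).symm q ≫ f) := by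
    rw [h.weakEquivalence_iff hQ hL, adj.homEquiv_naturality_right, Equiv.apply_symm_apply]
    infer_instance
  exact weakEquivalence_of_precomp ((adj.homEquiv Q K).symm q) f

end QuillenAdjunctions

section BicategoryCoherence

open Bicategory

variable {𝒞 : Type*} [Bicategory 𝒞] {a b c d e : 𝒞}

lemma whiskerLeft_rightAction {M : a ⟶ b} {X : b ⟶ c} {D : c ⟶ d} {Y : d ⟶ c}
    (ev : D ≫ Y ⟶ 𝟙 c) :
    (Bicategory.associator M (X ≫ D) Y).hom ≫
        M ◁ ((Bicategory.associator X D Y).hom ≫ X ◁ ev ≫ (Bicategory.rightUnitor X).hom) =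
      (Bicategory.associator M X D).inv ▷ Y ≫ (Bicategory.associator (M ≫ X) D Y).hom ≫
        (M ≫ X) ◁ ev ≫ (Bicategory.rightUnitor (M ≫ X)).hom := by
  simp

lemma whiskerRight_rightAction {N R : a ⟶ c} {D : c ⟶ d} {Y : d ⟶ c}
    (ev : D ≫ Y ⟶ 𝟙 c) (j : N ⟶ R) :
    (j ▷ D) ▷ Y ≫ (Bicategory.associator R D Y).hom ≫ R ◁ ev ≫ (Bicategory.rightUnitor R).hom =
      ((Bicategory.associator N D Y).hom ≫ N ◁ ev ≫ (Bicategory.rightUnitor N).hom) ≫ j := by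
  rw [Bicategory.associator_naturality_left_assoc, ← Bicategory.whisker_exchange_assoc,
    Bicategory.rightUnitor_naturality, Category.assoc, Category.assoc]

end BicategoryCoherence

section Transposes

variable {V : Type u} [Category.{v} V] [MonoidalCategory V] [SymmetricCategory V]
  [MonoidalClosed V] [HasCoequalizers V] {A B C E : Mon V}

lemma tensorπ_whiskerLeft (M : Bimod C A) {X X' : Bimod A B} (f : X ⟶ X') :
    tensorπ M X ≫ (Bimod.whiskerLeft M f).hom = M.X ◁ f.hom ≫ tensorπ M X' :=
  ι_colimMap _ _

variable [HasEqualizers V]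

lemma comp_transpose {M M' : Bimod C A} {X : Bimod A B} {N : Bimod C B} (p : M ⟶ M')
    (f : M'.tensorBimod X ⟶ N) :
    p ≫ transpose f = transpose (Bimod.whiskerRight p X ≫ f) := by
  apply Bimod.hom_ext
  apply map_hom_ext
  rw [transpose_ev, Bimod.comp_hom', Bimod.comp_hom', comp_whiskerRight, Category.assoc,
    transpose_ev, ← Category.assoc (tensorπ M X), tensorπ_whiskerRight, Category.assoc]

/-- The evaluation `Map_B(X, N) ⊗_A X ⟶ N` as a map of bimodules. -/
noncomputable def mapCounit (X : Bimod A B) (N : Bimod C B) :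
    (mapBimod X N).tensorBimod X ⟶ N :=
  untranspose (𝟙 _)

lemma transpose_mapCounit (X : Bimod A B) (N : Bimod C B) : transpose (mapCounit X N) = 𝟙 _ :=
  (transposeEquiv _ X N).right_inv _

lemma whiskerRight_transpose_mapCounit {M : Bimod C A} {X : Bimod A B} {N : Bimod C B}
    (f : M.tensorBimod X ⟶ N) :
    Bimod.whiskerRight (transpose f) X ≫ mapCounit X N = f := by
  rw [mapCounit, ← untranspose_comp, Category.comp_id]
  exact (transposeEquiv M X N).left_inv f

/-- The canonical map `M ⊗_E Map_B(X, N) ⟶ Map_B(X, M ⊗_E N)`, which compares the maps `ℓ` of `X`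
and of `M ⊗_A X`. -/
noncomputable def assembly (M : Bimod C E) (X : Bimod A B) (N : Bimod E B) :
    M.tensorBimod (mapBimod X N) ⟶ mapBimod X (M.tensorBimod N) :=
  transpose ((Bimod.associatorBimod M (mapBimod X N) X).hom ≫
    Bimod.whiskerLeft M (mapCounit X N))

lemma whiskerLeft_transpose_assembly (M : Bimod C E) {P : Bimod E A} {X : Bimod A B}
    {N : Bimod E B} (f : P.tensorBimod X ⟶ N) :
    Bimod.whiskerLeft M (transpose f) ≫ assembly M X N =
      transpose ((Bimod.associatorBimod M P X).hom ≫ Bimod.whiskerLeft M f) := by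
  rw [assembly, comp_transpose, Bimod.whisker_assoc_bimod, Category.assoc, Category.assoc,
    Iso.inv_hom_id_assoc, ← Bimod.whiskerLeft_comp_bimod, whiskerRight_transpose_mapCounit]

lemma whiskerLeft_transpose_leftUnitor_assembly (M : Bimod C A) (X : Bimod A B) :
    Bimod.whiskerLeft M (transpose (Bimod.leftUnitorBimod X).hom) ≫ assembly M X X =
      (Bimod.rightUnitorBimod M).hom ≫ transpose (𝟙 (M.tensorBimod X)) := by
  rw [whiskerLeft_transpose_assembly, Bimod.triangle_bimod, comp_transpose,
    Category.comp_id]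

/-- The map `ℓ_N : N ⊗_B Map_B(X, B) ⟶ Map_B(X, N)` for a `C`-`B`-bimodule `N`. When `N` is a right
`B`-module this is `dualMap X N`; the left action is needed to form `M ⊗_C ℓ_N`. -/
noncomputable def bimodDualMap (X : Bimod A B) (N : Bimod C B) :
    N.tensorBimod (mapBimod X (Bimod.regular B)) ⟶ mapBimod X N :=
  transpose ((Bimod.associatorBimod N (mapBimod X (Bimod.regular B)) X).hom ≫
    Bimod.whiskerLeft N (mapCounit X (Bimod.regular B)) ≫ (Bimod.rightUnitorBimod N).hom)

attribute [local instance] Bimod.monBicategory in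
lemma whiskerLeft_bimodDualMap_assembly (M : Bimod C A) (X : Bimod A B) :
    Bimod.whiskerLeft M (bimodDualMap X X) ≫ assembly M X X =
      (Bimod.associatorBimod M X (mapBimod X (Bimod.regular B))).inv ≫
        bimodDualMap X (M.tensorBimod X) := by
  rw [bimodDualMap, whiskerLeft_transpose_assembly, bimodDualMap, comp_transpose]
  congr 1
  exact whiskerLeft_rightAction (𝒞 := Mon V) (mapCounit X (Bimod.regular B))

attribute [local instance] Bimod.monBicategory in
lemma whiskerRight_bimodDualMap (X : Bimod A B) {N R : Bimod C B} (j : N ⟶ R) :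
    Bimod.whiskerRight j (mapBimod X (Bimod.regular B)) ≫ bimodDualMap X R =
      bimodDualMap X N ≫ mapMap X j := by
  rw [bimodDualMap, comp_transpose, bimodDualMap, ← transpose_comp]
  congr 1
  exact whiskerRight_rightAction (𝒞 := Mon V) (mapCounit X (Bimod.regular B)) j

end Transposes

section LeftModules

variable {V : Type u} [Category.{v} V] [MonoidalCategory V] {A B C D : Mon V}

/-- The left `A`-module given by an object with a left action of `A`. The right action of the unit
object that a `LeftMod` also carries is the right unitor. -/
abbrev LeftMod.ofAction (M : V) (l : A.X ⊗ M ⟶ M) (hone : η[A.X] ▷ M ≫ l = (λ_ M).hom)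
    (hmul : μ[A.X] ▷ M ≫ l = (α_ A.X A.X M).hom ≫ A.X ◁ l ≫ l) : LeftMod A where
  X := M
  actLeft := l
  one_actLeft := hone
  left_assoc := hmul
  actRight := (ρ_ M).hom
  actRight_one := by
    change M ◁ 𝟙 (𝟙_ V) ≫ _ = _
    simp
  right_assoc := by
    change M ◁ (λ_ (𝟙_ V)).hom ≫ _ = (α_ M (𝟙_ V) (𝟙_ V)).inv ≫ _ ▷ 𝟙_ V ≫ _
    monoidal
  middle_assoc := by
    change l ▷ 𝟙_ V ≫ (ρ_ M).hom = (α_ A.X M (𝟙_ V)).hom ≫ A.X ◁ (ρ_ M).hom ≫ l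
    simp

lemma LeftMod.actRight_eq (M : LeftMod A) : M.actRight = (ρ_ M.X).hom :=
  (Category.id_comp M.actRight).symm.trans
    ((congrArg (fun k => k ≫ M.actRight) (whiskerLeft_id M.X (𝟙_ V)).symm).trans M.actRight_one)

/-- A map that commutes with the left actions, as a morphism of left modules. -/
def LeftMod.homMk {M N : LeftMod A} (f : M.X ⟶ N.X) (hf : M.actLeft ≫ f = A.X ◁ f ≫ N.actLeft) :
    M ⟶ N where
  hom := f
  left_act_hom := hf
  right_act_hom := by
    rw [M.actRight_eq, N.actRight_eq]
    exact (rightUnitor_naturality f).symm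

/-- The left `A`-module underlying an `A`-`B`-bimodule. -/
def leftPart (X : Bimod A B) : LeftMod A :=
  LeftMod.ofAction X.X X.actLeft X.one_actLeft X.left_assoc

variable [HasCoequalizers V] [∀ X : V, PreservesColimitsOfSize.{0, 0} (tensorLeft X)]
  [∀ X : V, PreservesColimitsOfSize.{0, 0} (tensorRight X)]

/-- The left linear map `M ⊗_A X ⟶ N` underlying a map of bimodules, as a map out of the tensor
product of `M` with the left module underlying `X`. -/
noncomputable def forgetRight {M : Bimod C A} {X : Bimod A B} {N : Bimod C B}
    (f : M.tensorBimod X ⟶ N) : M.tensorBimod (leftPart X) ⟶ leftPart N :=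
  LeftMod.homMk f.hom f.left_act_hom

lemma forgetRight_whiskerRight_comp {M M' : Bimod C A} {X : Bimod A B} {N : Bimod C B}
    (p : M ⟶ M') (f : M'.tensorBimod X ⟶ N) :
    forgetRight (Bimod.whiskerRight p X ≫ f) =
      Bimod.whiskerRight p (leftPart X) ≫ forgetRight f :=
  Bimod.hom_ext _ _ rfl

lemma forgetRight_leftUnitor (X : Bimod A B) :
    forgetRight (Bimod.leftUnitorBimod X).hom = (Bimod.leftUnitorBimod (leftPart X)).hom :=
  Bimod.hom_ext _ _ rfl

lemma whiskerLeft_forgetRight_associator_comp {N : Bimod C D} {M : Bimod D A} {X : Bimod A B}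
    {P : Bimod D B} {R : Bimod C B} {Q : LeftMod A} (q : Q ⟶ leftPart X) (g : M.tensorBimod X ⟶ P)
    (f : N.tensorBimod P ⟶ R) :
    Bimod.whiskerLeft (N.tensorBimod M) q ≫
        forgetRight ((Bimod.associatorBimod N M X).hom ≫ Bimod.whiskerLeft N g ≫ f) =
      (Bimod.associatorBimod N M Q).hom ≫
        Bimod.whiskerLeft N (Bimod.whiskerLeft M q ≫ forgetRight g) ≫ forgetRight f := by
  have hforget : forgetRight ((Bimod.associatorBimod N M X).hom ≫ Bimod.whiskerLeft N g ≫ f) =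
      (Bimod.associatorBimod N M (leftPart X)).hom ≫ Bimod.whiskerLeft N (forgetRight g) ≫
        forgetRight f :=
    Bimod.hom_ext _ _ rfl
  rw [hforget, Bimod.comp_whiskerLeft_bimod, Bimod.whiskerLeft_comp_bimod, Category.assoc,
    Category.assoc, Iso.inv_hom_id_assoc, Category.assoc]

end LeftModules

section OppositeAlgebra

variable {V : Type u} [Category.{v} V] [MonoidalCategory V] [SymmetricCategory V]

lemma braiding_reverse (X Y Z : V) :
    (β_ (X ⊗ Y) Z).hom ≫ Z ◁ (β_ X Y).hom ≫ (α_ Z Y X).inv =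
      (α_ X Y Z).hom ≫ X ◁ (β_ Y Z).hom ≫ (β_ X (Z ⊗ Y)).hom := by
  rw [BraidedCategory.braiding_tensor_left_hom, BraidedCategory.braiding_tensor_right_hom]
  simp only [Category.assoc]

/-- The opposite algebra of `A`: its right modules are the left `A`-modules. -/
abbrev opAlgebra (A : Mon V) : Mon V where
  X := A.X
  mon :=
    { one := η[A.X]
      mul := (β_ A.X A.X).hom ≫ μ[A.X]
      one_mul := by
        rw [BraidedCategory.braiding_naturality_left_assoc, MonObj.mul_one]
        simp
      mul_one := by
        rw [BraidedCategory.braiding_naturality_right_assoc, MonObj.one_mul]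
        simp
      mul_assoc := by
        rw [comp_whiskerRight_assoc, BraidedCategory.braiding_naturality_left_assoc,
          MonoidalCategory.whiskerLeft_comp_assoc,
          BraidedCategory.braiding_naturality_right_assoc, MonObj.mul_assoc_flip,
          BraidedCategory.braiding_naturality_left_assoc, reassoc_of% braiding_reverse] }

lemma leftAction_one_of_rightAction {A P : V} (e : 𝟙_ V ⟶ A) (r : P ⊗ A ⟶ P)
    (h : P ◁ e ≫ r = (ρ_ P).hom) : e ▷ P ≫ (β_ A P).hom ≫ r = (λ_ P).hom := by
  rw [BraidedCategory.braiding_naturality_left_assoc, h]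
  simp

lemma rightAction_one_of_leftAction {A P : V} (e : 𝟙_ V ⟶ A) (l : A ⊗ P ⟶ P)
    (h : e ▷ P ≫ l = (λ_ P).hom) : P ◁ e ≫ (β_ P A).hom ≫ l = (ρ_ P).hom := by
  rw [BraidedCategory.braiding_naturality_right_assoc, h]
  simp

lemma leftAction_mul_of_rightAction {A P : V} (m : A ⊗ A ⟶ A) (r : P ⊗ A ⟶ P)
    (h : P ◁ m ≫ r = (α_ P A A).inv ≫ r ▷ A ≫ r) :
    ((β_ A A).hom ≫ m) ▷ P ≫ (β_ A P).hom ≫ r =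
      (α_ A A P).hom ≫ A ◁ ((β_ A P).hom ≫ r) ≫ (β_ A P).hom ≫ r := by
  rw [comp_whiskerRight_assoc, BraidedCategory.braiding_naturality_left_assoc m, h,
    BraidedCategory.braiding_naturality_left_assoc (β_ A A).hom, reassoc_of% braiding_reverse,
    MonoidalCategory.whiskerLeft_comp_assoc,
    BraidedCategory.braiding_naturality_right_assoc A r]

lemma rightAction_mul_of_leftAction {A P : V} (m : A ⊗ A ⟶ A) (l : A ⊗ P ⟶ P)
    (h : m ▷ P ≫ l = (α_ A A P).hom ≫ A ◁ l ≫ l) :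
    P ◁ ((β_ A A).hom ≫ m) ≫ (β_ P A).hom ≫ l =
      (α_ P A A).inv ≫ ((β_ P A).hom ≫ l) ▷ A ≫ (β_ P A).hom ≫ l := by
  rw [← cancel_epi (α_ P A A).hom, Iso.hom_inv_id_assoc, MonoidalCategory.whiskerLeft_comp_assoc,
    BraidedCategory.braiding_naturality_right_assoc P m, h, ← reassoc_of% braiding_reverse,
    Iso.inv_hom_id_assoc, comp_whiskerRight_assoc,
    BraidedCategory.braiding_naturality_left_assoc l,
    BraidedCategory.braiding_naturality_left_assoc (β_ P A).hom]

lemma leftLinear_of_rightLinear {A P L : V} (f : P ⟶ L) (r : P ⊗ A ⟶ P) (l : A ⊗ L ⟶ L)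
    (h : r ≫ f = f ▷ A ≫ (β_ L A).hom ≫ l) : ((β_ A P).hom ≫ r) ≫ f = A ◁ f ≫ l := by
  rw [Category.assoc, h, BraidedCategory.braiding_naturality_left_assoc,
    SymmetricCategory.symmetry_assoc]

variable {A : Mon V}

/-- The left `A`-module corresponding to a right module over the opposite algebra. -/
abbrev LeftMod.ofOp (P : RightMod (opAlgebra A)) : LeftMod A :=
  LeftMod.ofAction P.X ((β_ A.X P.X).hom ≫ P.actRight)
    (leftAction_one_of_rightAction _ _ P.actRight_one)
    (by simpa only [SymmetricCategory.symmetry_assoc] using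
      leftAction_mul_of_rightAction ((β_ A.X A.X).hom ≫ μ[A.X]) _ P.right_assoc)

/-- The right module over the opposite algebra corresponding to a left `A`-module. -/
def LeftMod.toOp (L : LeftMod A) : RightMod (opAlgebra A) :=
  RightMod.ofAction L.X ((β_ L.X A.X).hom ≫ L.actLeft)
    (rightAction_one_of_leftAction _ _ L.one_actLeft)
    (rightAction_mul_of_leftAction _ _ L.left_assoc)

/-- The left module over the opposite algebra corresponding to a right `A`-module. -/
abbrev RightMod.toOp (M : RightMod A) : LeftMod (opAlgebra A) :=
  LeftMod.ofAction M.X ((β_ A.X M.X).hom ≫ M.actRight)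
    (leftAction_one_of_rightAction _ _ M.actRight_one)
    (leftAction_mul_of_rightAction _ _ M.right_assoc)

/-- The left linear map `P ⟶ L` corresponding to a right linear map over the opposite algebra. -/
def LeftMod.homOfOp {P : RightMod (opAlgebra A)} {L : LeftMod A} (f : P ⟶ L.toOp) :
    LeftMod.ofOp P ⟶ L :=
  LeftMod.homMk f.hom (leftLinear_of_rightLinear f.hom P.actRight L.actLeft f.right_act_hom)

/-- A right linear map as a left linear map over the opposite algebra. -/
def RightMod.mapToOp {M N : RightMod A} (f : M ⟶ N) : M.toOp ⟶ N.toOp :=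
  LeftMod.homMk f.hom <| by
    rw [Category.assoc, f.right_act_hom, BraidedCategory.braiding_naturality_right_assoc]

lemma balanced_braiding {A M P Z : V} (r : M ⊗ A ⟶ M) (s : P ⊗ A ⟶ P) (k : P ⊗ M ⟶ Z)
    (h : s ▷ M ≫ k = (α_ P A M).hom ≫ P ◁ ((β_ A M).hom ≫ r) ≫ k) :
    r ▷ P ≫ (β_ M P).hom ≫ k = (α_ M A P).hom ≫ M ◁ ((β_ A P).hom ≫ s) ≫ (β_ M P).hom ≫ k := by
  have h' : P ◁ r ≫ k = P ◁ (β_ M A).hom ≫ (α_ P A M).inv ≫ s ▷ M ≫ k := by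
    rw [h, Iso.inv_hom_id_assoc, ← MonoidalCategory.whiskerLeft_comp_assoc,
      SymmetricCategory.symmetry_assoc]
  rw [BraidedCategory.braiding_naturality_left_assoc, h', reassoc_of% braiding_reverse,
    MonoidalCategory.whiskerLeft_comp_assoc, BraidedCategory.braiding_naturality_right_assoc M s]

variable [MonoidalClosed V] [HasCoequalizers V]

/-- The symmetry `M ⊗_A P ≅ P ⊗_{Aᵒᵖ} M`. -/
noncomputable def tensorSwap (M : RightMod A) (P : RightMod (opAlgebra A)) :
    (M.tensorBimod (LeftMod.ofOp P)).X ≅ (P.tensorBimod M.toOp).X where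
  hom := tensorDesc (M := M) (X := LeftMod.ofOp P) ((β_ M.X P.X).hom ≫ tensorπ P M.toOp)
    (balanced_braiding M.actRight P.actRight _ (tensorπ_condition P M.toOp))
  inv := tensorDesc (M := P) (X := M.toOp) ((β_ P.X M.X).hom ≫ tensorπ M (LeftMod.ofOp P))
    (balanced_braiding (A := A.X) P.actRight M.actRight _
      (tensorπ_condition M (LeftMod.ofOp P)))
  hom_inv_id := by
    apply tensor_hom_ext
    rw [← Category.assoc, tensorπ_desc, Category.assoc, tensorπ_desc]
    exact (SymmetricCategory.symmetry_assoc _ _ _).trans (Category.comp_id _).symm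
  inv_hom_id := by
    apply tensor_hom_ext
    rw [← Category.assoc, tensorπ_desc, Category.assoc, tensorπ_desc]
    exact (SymmetricCategory.symmetry_assoc _ _ _).trans (Category.comp_id _).symm

lemma tensorSwap_naturality_left {M M' : RightMod A} (f : M ⟶ M')
    (P : RightMod (opAlgebra A)) :
    (Bimod.whiskerRight f (LeftMod.ofOp P)).hom ≫ (tensorSwap M' P).hom =
      (tensorSwap M P).hom ≫ (Bimod.whiskerLeft P (RightMod.mapToOp f)).hom := by
  apply tensor_hom_ext
  rw [← Category.assoc, tensorπ_whiskerRight, tensorSwap, tensorSwap, Category.assoc, tensorπ_desc,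
    ← Category.assoc (tensorπ _ _), tensorπ_desc, Category.assoc, tensorπ_whiskerLeft]
  exact BraidedCategory.braiding_naturality_left_assoc f.hom P.X _

end OppositeAlgebra

section HomotopyFlatness

variable {V : Type u} [Category.{v} V] [MonoidalCategory V] {A B : Mon V}

instance isIso_hom_hom {M N : Bimod A B} (e : M ≅ N) : IsIso e.hom.hom :=
  inferInstanceAs (IsIso ((Bimod.forget (B := B) A).map e.hom))

instance isIso_inv_hom {M N : Bimod A B} (e : M ≅ N) : IsIso e.inv.hom :=
  inferInstanceAs (IsIso ((Bimod.forget (B := B) A).map e.inv))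

lemma weakEquivalence_hom_precomp_iff [ModelCategory V] {M N K : Bimod A B} (f : M ⟶ N)
    (g : N ⟶ K) [WeakEquivalence f.hom] : WeakEquivalence (f ≫ g).hom ↔ WeakEquivalence g.hom :=
  weakEquivalence_precomp_iff f.hom g.hom

variable [SymmetricCategory V] [MonoidalClosed V] [ModelCategory V]

lemma HomotopyFlat.whiskerLeft {M : RightMod A} (hM : HomotopyFlat M) {P Q : Bimod A B}
    (f : P ⟶ Q) (hf : WeakEquivalence f.hom) : WeakEquivalence (Bimod.whiskerLeft M f).hom :=
  hM (P := leftPart P) (Q := leftPart Q) (LeftMod.homMk f.hom f.left_act_hom) hf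

/-- A left `A`-module `L` is homotopy flat if `- ⊗_A L`, from right `A`-modules to `V`, preserves
the maps whose underlying map is a weak equivalence. -/
def LeftHomotopyFlat (L : LeftMod A) : Prop :=
  ∀ {M N : RightMod A} (f : M ⟶ N), WeakEquivalence f.hom →
    WeakEquivalence (Bimod.whiskerRight f L).hom

lemma HomotopyFlat.leftHomotopyFlat {P : RightMod (opAlgebra A)} (hP : HomotopyFlat P) :
    LeftHomotopyFlat (LeftMod.ofOp P) := by
  intro M N f hf
  have : WeakEquivalence (Bimod.whiskerLeft P (RightMod.mapToOp f)).hom := hP _ hf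
  exact weakEquivalence_of_postcomp_of_fac (tensorSwap_naturality_left f P)

/-- The part of the module hypothesis and of the CHF hypothesis that concerns right modules over the
single algebra `A`. -/
class CHFAlgebra (A : Mon V) [ModelCategory (RightMod A)] : Prop where
  weakEquivalence_iff {M N : RightMod A} (f : M ⟶ N) :
    WeakEquivalence f ↔ WeakEquivalence f.hom
  homotopyFlat (M : RightMod A) : IsCofibrant M → HomotopyFlat M

lemma exists_leftHomotopyFlat_resolution [ModelCategory (RightMod (opAlgebra A))]
    [CHFAlgebra (opAlgebra A)] (L : LeftMod A) :
    ∃ (Q : LeftMod A) (q : Q ⟶ L), LeftHomotopyFlat Q ∧ WeakEquivalence q.hom := by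
  obtain ⟨P, hP, p, -, hp⟩ := CofibrantObject.HoCat.exists_resolution L.toOp
  have hPflat : HomotopyFlat P := CHFAlgebra.homotopyFlat P hP
  exact ⟨LeftMod.ofOp P, LeftMod.homOfOp p, hPflat.leftHomotopyFlat,
    (CHFAlgebra.weakEquivalence_iff p).1 hp⟩

lemma HomotopyFlat.whiskerRight [ModelCategory (RightMod (opAlgebra A))]
    [CHFAlgebra (opAlgebra A)] {M N : RightMod A} (hM : HomotopyFlat M) (hN : HomotopyFlat N)
    (f : M ⟶ N) (hf : WeakEquivalence f.hom) (X : Bimod A B) :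
    WeakEquivalence (Bimod.whiskerRight f X).hom := by
  obtain ⟨Q, q, hQ, hq⟩ := exists_leftHomotopyFlat_resolution (leftPart X)
  have hMq := hM q hq
  have hNq := hN q hq
  have hfQ := hQ f hf
  change WeakEquivalence (Bimod.whiskerRight f (leftPart X)).hom
  rwa [← weakEquivalence_hom_precomp_iff (Bimod.whiskerLeft M q), Bimod.whisker_exchange_bimod,
    weakEquivalence_hom_precomp_iff]

end HomotopyFlatness

section DerivedTransposition

variable {V : Type u} [Category.{v} V] [MonoidalCategory V] [SymmetricCategory V]
  [MonoidalClosed V] [ModelCategory V] {A B : Mon V} {X : Bimod A B}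

lemma governedAdj_homEquiv {M : RightMod A} {N : RightMod B}
    (f : (tensorFunctor X).obj M ⟶ N) :
    (governedAdj X).homEquiv M N f = transpose (X := X) f := by
  rw [governedAdj, tensorMapAdj, Adjunction.mkOfHomEquiv_homEquiv]
  rfl

variable [ModelCategory (RightMod A)] [ModelCategory (RightMod B)]

lemma IsQuillenEquivalence.weakEquivalence_transpose_iff
    (h : IsQuillenEquivalence (governedAdj X)) {M : RightMod A} {N : RightMod B}
    (hM : IsCofibrant M) (hN : IsFibrant N) (f : M.tensorBimod X ⟶ N) :
    WeakEquivalence (transpose f) ↔ WeakEquivalence f := by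
  rw [← governedAdj_homEquiv f]
  exact (h.weakEquivalence_iff hM hN f).symm

variable [CHFAlgebra A] [CHFAlgebra B]

lemma IsQuillenEquivalence.weakEquivalence_transpose_iff_of_leftHomotopyFlat
    (h : IsQuillenEquivalence (governedAdj X)) {Q : LeftMod A} (hQ : LeftHomotopyFlat Q)
    (q : Q ⟶ leftPart X) (hq : WeakEquivalence q.hom) {M : RightMod A} {N : RightMod B}
    (hN : IsFibrant N) (f : M.tensorBimod X ⟶ N) :
    WeakEquivalence (transpose f).hom ↔
      WeakEquivalence (Bimod.whiskerLeft M q ≫ forgetRight f).hom := by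
  obtain ⟨P, hP, p, -, hp⟩ := CofibrantObject.HoCat.exists_resolution M
  rw [CHFAlgebra.weakEquivalence_iff] at hp
  have hPq : WeakEquivalence (Bimod.whiskerLeft P q).hom := CHFAlgebra.homotopyFlat P hP q hq
  have hpQ : WeakEquivalence (Bimod.whiskerRight p Q).hom := hQ p hp
  have exchange : Bimod.whiskerLeft P q ≫ forgetRight (Bimod.whiskerRight p X ≫ f) =
      Bimod.whiskerRight p Q ≫ Bimod.whiskerLeft M q ≫ forgetRight f := by
    rw [forgetRight_whiskerRight_comp, ← Category.assoc, Bimod.whisker_exchange_bimod,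
      Category.assoc]
  calc WeakEquivalence (transpose f).hom
    _ ↔ WeakEquivalence (p ≫ transpose f).hom := by
        rw [weakEquivalence_hom_precomp_iff]
    _ ↔ WeakEquivalence (Bimod.whiskerRight p X ≫ f).hom := by
        rw [comp_transpose, ← CHFAlgebra.weakEquivalence_iff,
          h.weakEquivalence_transpose_iff hP hN, CHFAlgebra.weakEquivalence_iff]
    _ ↔ WeakEquivalence (Bimod.whiskerLeft P q ≫
          forgetRight (Bimod.whiskerRight p X ≫ f)).hom :=
        (weakEquivalence_hom_precomp_iff (Bimod.whiskerLeft P q)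
          (forgetRight (Bimod.whiskerRight p X ≫ f))).symm
    _ ↔ WeakEquivalence (Bimod.whiskerLeft M q ≫ forgetRight f).hom := by
        rw [exchange, weakEquivalence_hom_precomp_iff]

lemma IsQuillenEquivalence.weakEquivalence_mapCounit (h : IsQuillenEquivalence (governedAdj X))
    {Q : LeftMod A} (hQ : LeftHomotopyFlat Q) (q : Q ⟶ leftPart X) (hq : WeakEquivalence q.hom)
    {C : Mon V} {N : Bimod C B} (hN : IsFibrant (rightPart N)) :
    WeakEquivalence (Bimod.whiskerLeft (mapBimod X N) q ≫ forgetRight (mapCounit X N)).hom := by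
  change WeakEquivalence (Bimod.whiskerLeft (mapBimod X (rightPart N)) q ≫
    forgetRight (mapCounit X (rightPart N))).hom
  rw [← h.weakEquivalence_transpose_iff_of_leftHomotopyFlat hQ q hq hN, transpose_mapCounit,
    Bimod.id_hom']
  infer_instance

variable [ModelCategory (RightMod (opAlgebra A))] [CHFAlgebra (opAlgebra A)]

lemma IsQuillenEquivalence.weakEquivalence_unitMap (h : IsQuillenEquivalence (governedAdj X))
    (hX : IsFibrant (rightPart X)) : WeakEquivalence (unitMap X).hom := by
  obtain ⟨Q, q, hQ, hq⟩ := exists_leftHomotopyFlat_resolution (leftPart X)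
  let l : (rightPart (Bimod.regular A)).tensorBimod X ⟶ rightPart X :=
    RightMod.homMk (Bimod.leftUnitorBimod X).hom.hom (Bimod.leftUnitorBimod X).hom.right_act_hom
  refine (h.weakEquivalence_transpose_iff_of_leftHomotopyFlat hQ q hq hX l).2 ?_
  have key : Bimod.whiskerLeft (Bimod.regular A) q ≫ forgetRight (Bimod.leftUnitorBimod X).hom =
      (Bimod.leftUnitorBimod Q).hom ≫ q := by
    rw [forgetRight_leftUnitor, Bimod.id_whiskerLeft_bimod]
    simp
  have : WeakEquivalence ((Bimod.leftUnitorBimod Q).hom ≫ q).hom := by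
    rw [Bimod.comp_hom']
    infer_instance
  rwa [← key] at this

lemma IsQuillenEquivalence.weakEquivalence_dualMap (h : IsQuillenEquivalence (governedAdj X))
    (hB : IsFibrant (rightPart (Bimod.regular B))) {N : RightMod B} (hNf : IsFibrant N)
    (hNc : IsCofibrant N) : WeakEquivalence (dualMap X N).hom := by
  obtain ⟨Q, q, hQ, hq⟩ := exists_leftHomotopyFlat_resolution (leftPart X)
  have hev : WeakEquivalence (Bimod.whiskerLeft (mapBimod X (Bimod.regular B)) q ≫
      forgetRight (mapCounit X (Bimod.regular B))).hom :=
    h.weakEquivalence_mapCounit hQ q hq hB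
  have hNev : WeakEquivalence (Bimod.whiskerLeft N
      (Bimod.whiskerLeft (mapBimod X (Bimod.regular B)) q ≫ forgetRight (dualEv X))).hom :=
    CHFAlgebra.homotopyFlat N hNc _ hev
  have : WeakEquivalence (forgetRight (Bimod.rightUnitorBimod N).hom).hom :=
    inferInstanceAs (WeakEquivalence (Bimod.rightUnitorBimod N).hom.hom)
  refine (h.weakEquivalence_transpose_iff_of_leftHomotopyFlat hQ q hq hNf _).2 ?_
  rw [whiskerLeft_forgetRight_associator_comp q]
  rwa [weakEquivalence_hom_precomp_iff, weakEquivalence_hom_precomp_iff]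

end DerivedTransposition

section DerivedUnit

variable {V : Type u} [Category.{v} V] [MonoidalCategory V] [SymmetricCategory V]
  [MonoidalClosed V] [ModelCategory V] {A B : Mon V} {X : Bimod A B}

lemma weakEquivalence_transpose [ModelCategory (RightMod (opAlgebra B))]
    [CHFAlgebra (opAlgebra B)] (hη : WeakEquivalence (unitMap X).hom)
    (hX : WeakEquivalence (dualMap X (rightPart X)).hom) {M : RightMod A} (hM : HomotopyFlat M)
    (hMX : HomotopyFlat (M.tensorBimod X)) {R : RightMod B} (hR : HomotopyFlat R)
    (hℓ : WeakEquivalence (dualMap X R).hom) (j : M.tensorBimod X ⟶ R)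
    (hj : WeakEquivalence j.hom) : WeakEquivalence (transpose j).hom := by
  let D := mapBimod X (Bimod.regular B)
  have : WeakEquivalence (Bimod.whiskerLeft M (unitMap X)).hom := hM.whiskerLeft _ hη
  have : WeakEquivalence (Bimod.whiskerLeft M (bimodDualMap X X)).hom := hM.whiskerLeft _ hX
  have : WeakEquivalence (bimodDualMap X R).hom := hℓ
  have : WeakEquivalence (Bimod.whiskerRight j D).hom := hMX.whiskerRight hR j hj D
  let comparison := assembly M X X ≫ mapMap X j
  have fac_dual : Bimod.whiskerLeft M (bimodDualMap X X) ≫ comparison =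
      (Bimod.associatorBimod M X D).inv ≫ Bimod.whiskerRight j D ≫ bimodDualMap X R := by
    rw [whiskerRight_bimodDualMap, ← Category.assoc, whiskerLeft_bimodDualMap_assembly,
      Category.assoc]
  have fac_unit : Bimod.whiskerLeft M (unitMap X) ≫ comparison =
      (Bimod.rightUnitorBimod M).hom ≫ transpose j := by
    rw [unitMap, ← Category.assoc, whiskerLeft_transpose_leftUnitor_assembly, Category.assoc,
      ← transpose_comp, Category.id_comp]
  have hcomparison : WeakEquivalence comparison.hom := by
    rwa [← weakEquivalence_hom_precomp_iff (Bimod.whiskerLeft M (bimodDualMap X X)), fac_dual,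
      weakEquivalence_hom_precomp_iff, weakEquivalence_hom_precomp_iff]
  rwa [← weakEquivalence_hom_precomp_iff (Bimod.rightUnitorBimod M).hom, ← fac_unit,
    weakEquivalence_hom_precomp_iff]

end DerivedUnit

end HomotopicalMorita

open HomotopicalMorita in
theorem mainTheorem3_general {V : Type u} [Category.{v} V] [MonoidalCategory V]
    [SymmetricCategory V] [MonoidalClosed V] [ModelCategory V]
    [∀ A : Mon V, ModelCategory (RightMod A)] {A B : Mon V} [CHFAlgebra A]
    [CHFAlgebra (opAlgebra A)] [CHFAlgebra B] [CHFAlgebra (opAlgebra B)] (X : Bimod A B)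
    (hQ : IsQuillenAdjunction (governedAdj X)) (hB : IsFibrant (rightPart (Bimod.regular B)))
    (hXf : IsFibrant (rightPart X)) (hXc : IsCofibrant (rightPart X)) :
    IsQuillenEquivalence (governedAdj X) ↔
      WeakEquivalence (unitMap X).hom ∧ HomotopyCofaithful X ∧ HomotopyRightDualizable X := by
  constructor
  · intro h
    refine ⟨h.weakEquivalence_unitMap hXf, fun hM hN f hf ↦ ?_, fun N hNf hNc ↦ ?_⟩
    · exact h.weakEquivalence_of_map hM hN f ((CHFAlgebra.weakEquivalence_iff _).2 hf)
    · exact (CHFAlgebra.weakEquivalence_iff _).2 (h.weakEquivalence_dualMap hB hNf hNc)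
  · rintro ⟨hη, hcofaithful, hdualizable⟩
    have hℓ {N : RightMod B} (hNf : IsFibrant N) (hNc : IsCofibrant N) :
        WeakEquivalence (dualMap X N).hom :=
      (CHFAlgebra.weakEquivalence_iff _).1 (hdualizable N hNf hNc)
    refine hQ.isQuillenEquivalence
      (fun hK hL f hf ↦ hcofaithful hK hL f ((CHFAlgebra.weakEquivalence_iff _).1 hf))
      fun {M R} hM hR j hj hj' ↦ ?_
    have hMX : IsCofibrant ((tensorFunctor X).obj M) := hQ.isCofibrant_obj hM
    have hRc : IsCofibrant R := isCofibrant_of_cofibration j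
    rw [governedAdj_homEquiv]
    refine (CHFAlgebra.weakEquivalence_iff _).2 ?_
    exact weakEquivalence_transpose hη (hℓ hXf hXc) (CHFAlgebra.homotopyFlat M hM)
      (CHFAlgebra.homotopyFlat _ hMX) (CHFAlgebra.homotopyFlat R hRc) (hℓ hR hRc) j
      ((CHFAlgebra.weakEquivalence_iff j).1 hj')

theorem mainTheorem3 {V : Type u} [Category.{v} V] [MonoidalCategory V] [SymmetricCategory V]
    [MonoidalClosed V] [ModelCategory V] [∀ A : Mon V, ModelCategory (HomotopicalMorita.RightMod A)]
    (hV : HomotopicalMorita.ModuleHypothesis V) (hCHF : HomotopicalMorita.CHFHypothesis V)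
    (A B : Mon V) (X : Bimod A B)
    (hQ : HomotopicalMorita.IsQuillenAdjunction (HomotopicalMorita.governedAdj X))
    (hB : IsFibrant (HomotopicalMorita.rightPart (Bimod.regular B)))
    (hXf : IsFibrant (HomotopicalMorita.rightPart X))
    (hXc : IsCofibrant (HomotopicalMorita.rightPart X)) :
    HomotopicalMorita.IsQuillenEquivalence (HomotopicalMorita.governedAdj X) ↔
      WeakEquivalence (HomotopicalMorita.unitMap X).hom ∧
      HomotopicalMorita.HomotopyCofaithful X ∧
      HomotopicalMorita.HomotopyRightDualizable X := by
  have (C : Mon V) : HomotopicalMorita.CHFAlgebra C := ⟨hV.right C, hCHF C⟩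
  exact mainTheorem3_general X hQ hB hXf hXc
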